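/- **Theorem (Weighted Ehrhart Reciprocity).** Let $N$ be a lattice of rank $d$ and $N_{\mathbb R}=N\otimes_{\mathbb Z}\mathbb R$. Let $\Sigma$ be a complete, simplicial, rational (finite) fan in $N_{\mathbb R}$ with rays $\rho_1,\dots,\rho_r$ and primitive integer generators $v_1,\dots,v_r\in N$, and for each $i$ let $b_i=a_iv_i$ with $a_i$ a positive integer. Let $\psi\colon |\Sigma| = N_{\mathbb R}\to\mathbb R$ be the function that is linear on each cone of $\Sigma$ and satisfies $\psi(b_i)=1$ for $i=1,\dots,r$, let $Q=\{v\in|\Sigma| : \psi(v)\le 1\}$, and for $v\in|\Sigma|\cap N$ put $w_0(v)=\psi(v)-\lceil\psi(v)\rceil$. For a rational number $k$ and an integer $m\ge 0$ let $f^0_k(m)$ be the number of lattice points $v\in mQ\cap N$ with $w_0(v)=k$; these numbers are finite. Then for every rational number $k$ with $-1<k\le 0$, the function $m\mapsto f^0_k(m)$ $(m\in\mathbb Z_{\ge 0})$ is either identically zero or given by a polynomial in $\mathbb Q[t]$ of degree $d$ with positive leading coefficient. Moreover, writing $f^0_k(-m)$ for the value of this polynomial at $-m$, for every positive integer $m$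 $$f^0_k(-m)=\begin{cases}(-1)^d f^0_0(m-1) & \text{if } k=0,\\ (-1)^d f^0_{-1-k}(m) & \text{if } -1<k<0.\end{cases}$$ -/

import Mathlib

open scoped Pointwise

namespace WeightedEhrhart

variable {E : Type*} [AddCommGroup E] [Module ℝ E]

/-- A rational fan with respect to `N` in the real vector space `E`: a finite non-empty collection
of strongly convex cones, each generated by finitely many elements of `N`, which is closed under
taking faces and in which any two cones meet in a common face. -/
structure Fan (N : Submodule ℤ E) where
  /-- The cones of the fan. -/
  cones : Set (PointedCone ℝ E)
  finite : cones.Finite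
  nonempty : cones.Nonempty
  rational : ∀ σ ∈ cones, ∃ s : Set E, s.Finite ∧ s ⊆ (N : Set E) ∧ PointedCone.hull ℝ s = σ
  salient : ∀ σ ∈ cones, (σ : ConvexCone ℝ E).Salient
  face_mem : ∀ σ ∈ cones, ∀ τ : PointedCone ℝ E, τ.IsFaceOf σ → τ ∈ cones
  inf_isFaceOf : ∀ σ ∈ cones, ∀ τ ∈ cones, (σ ⊓ τ).IsFaceOf σ ∧ (σ ⊓ τ).IsFaceOf τ

/-- The dimension of a cone: the dimension of its linear span. -/
noncomputable def coneDim (σ : PointedCone ℝ E) : ℕ :=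
  Module.finrank ℝ (Submodule.span ℝ (σ : Set E))

/-- `v` is the primitive integer generator of the ray `ρ`. -/
structure IsPrimitiveGenerator (N : Submodule ℤ E) (ρ : PointedCone ℝ E) (v : E) : Prop where
  mem_lattice : v ∈ N
  mem_ray : v ∈ ρ
  ne_zero : v ≠ 0
  exists_nsmul : ∀ w ∈ N, w ∈ ρ → ∃ n : ℕ, w = n • v

namespace Fan

variable {N : Submodule ℤ E}

/-- The support `|Σ|` of a fan: the union of its cones. -/
def support (F : Fan N) : Set E := {v | ∃ σ ∈ F.cones, v ∈ σ}

/-- A fan is complete if its support is the whole space. -/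
def IsComplete (F : Fan N) : Prop := F.support = Set.univ

/-- A fan is simplicial if each of its cones is generated by linearly independent vectors. -/
def IsSimplicial (F : Fan N) : Prop :=
  ∀ σ ∈ F.cones, PointedCone.IsSimplicial σ

/-- The rays of a fan: its one-dimensional cones. -/
def rays (F : Fan N) : Set (PointedCone ℝ E) := {ρ | ρ ∈ F.cones ∧ coneDim ρ = 1}

end Fan

/-- A stacky fan `(N, Σ, {b_ρ})`: a simplicial rational fan `Σ` together with, for every ray `ρ`,
a positive integer multiple `b_ρ` of the primitive integer generator of `ρ`. -/
structure StackyFan (N : Submodule ℤ E) where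
  /-- The underlying fan. -/
  fan : Fan N
  simplicial : fan.IsSimplicial
  /-- The chosen lattice point on each ray. -/
  b : fan.rays → E
  b_spec : ∀ ρ : fan.rays, ∃ v : E, ∃ a : ℕ,
    IsPrimitiveGenerator N ρ.1 v ∧ 0 < a ∧ b ρ = a • v

namespace StackyFan

variable {N : Submodule ℤ E}

/-- `ψ` is linear on each cone of the fan and takes the value `1` at each `b_ρ`. (As the `b_ρ`
are lattice points and the cones are simplicial, such a function is automatically `ℚ`-linear on
each cone, that is, rational on lattice points.) -/
structure IsPiecewiseLinear (S : StackyFan N) (ψ : E → ℝ) : Prop where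
  linear : ∀ σ ∈ S.fan.cones, ∃ ℓ : E →ₗ[ℝ] ℝ, ∀ v ∈ σ, ψ v = ℓ v
  map_b : ∀ ρ : S.fan.rays, ψ (S.b ρ) = 1

theorem b_mem (S : StackyFan N) (ρ : S.fan.rays) : S.b ρ ∈ ρ.1 := by
  obtain ⟨v, a, hv, ha, h⟩ := S.b_spec ρ
  rw [h]
  exact nsmul_mem hv.mem_ray a

theorem b_ne_zero (S : StackyFan N) (ρ : S.fan.rays) : S.b ρ ≠ 0 := by
  obtain ⟨v, a, hv, ha, h⟩ := S.b_spec ρ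
  rw [h, ← Nat.cast_smul_eq_nsmul ℝ]
  exact smul_ne_zero (by exact_mod_cast ha.ne') hv.ne_zero

theorem mem_hull_singleton {s x : E} :
    x ∈ PointedCone.hull ℝ {s} ↔ ∃ c : ℝ, 0 ≤ c ∧ c • s = x := by
  rw [PointedCone.hull, Submodule.mem_span_singleton]
  constructor
  · rintro ⟨c, rfl⟩
    exact ⟨c.1, c.2, rfl⟩
  · rintro ⟨c, hc, rfl⟩
    exact ⟨⟨c, hc⟩, rfl⟩

theorem isFaceOf_hull_singleton {s : Set E} (hs : LinearIndepOn ℝ id s) {x : E} (hx : x ∈ s) :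
    (PointedCone.hull ℝ {x}).IsFaceOf (PointedCone.hull ℝ s) := by
  classical
  -- coordinates with respect to `s`
  have hex : ∀ g : E → ℝ, ∃ φ : E →ₗ[ℝ] ℝ, ∀ y ∈ s, φ y = g y := by
    intro g
    let B := Module.Basis.extend hs
    refine ⟨B.constr ℝ (fun i => g i.1), fun y hy => ?_⟩
    have : B ⟨y, hs.subset_extend _ hy⟩ = y := by simp [B]
    conv_lhs => rw [← this]
    rw [Module.Basis.constr_basis]
  have hnn : ∀ (φ : E →ₗ[ℝ] ℝ), (∀ y ∈ s, 0 ≤ φ y) → ∀ v ∈ PointedCone.hull ℝ s, 0 ≤ φ v := by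
    intro φ hφ v hv
    induction hv using Submodule.span_induction with
    | mem y hy => exact hφ y hy
    | zero => simp
    | add a b _ _ ha hb => rw [map_add]; exact add_nonneg ha hb
    | smul c a _ ha =>
      have : φ (c • a) = c.1 * φ a := by
        rw [← smul_eq_mul, ← map_smul]; rfl
      rw [this]; exact mul_nonneg c.2 ha
  obtain ⟨φ, hφ⟩ := hex (fun y => if y = x then 0 else 1)
  have hφ0 : ∀ v ∈ PointedCone.hull ℝ s, φ v = 0 → v ∈ PointedCone.hull ℝ {x} := by
    intro v hv
    induction hv using Submodule.span_induction with
    | mem y hy =>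
      intro h
      rw [hφ y hy] at h
      split_ifs at h with hyx
      · subst hyx
        exact Submodule.subset_span rfl
      · simp at h
    | zero => intro _; exact zero_mem _
    | add a b ha' hb' ha hb =>
      intro h
      rw [map_add] at h
      have h1 := hnn φ (fun y hy => by rw [hφ y hy]; split_ifs <;> simp) a ha'
      have h2 := hnn φ (fun y hy => by rw [hφ y hy]; split_ifs <;> simp) b hb'
      exact add_mem (ha (by linarith)) (hb (by linarith))
    | smul c a ha' ha =>
      intro h
      have hc : φ (c • a) = c.1 * φ a := by
        rw [← smul_eq_mul, ← map_smul]; rfl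
      rw [hc] at h
      rcases mul_eq_zero.1 h with h | h
      · have : c = 0 := Subtype.ext h
        rw [this, zero_smul]
        exact zero_mem _
      · exact Submodule.smul_mem _ _ (ha h)
  refine PointedCone.IsFaceOf.of_mem_of_add_mem_left
    (Submodule.span_mono (Set.singleton_subset_iff.2 hx)) ?_
  intro u v hu hv huv
  apply hφ0 u hu
  have h1 := hnn φ (fun y hy => by rw [hφ y hy]; split_ifs <;> simp) u hu
  have h2 := hnn φ (fun y hy => by rw [hφ y hy]; split_ifs <;> simp) v hv
  obtain ⟨c, -, hc⟩ := mem_hull_singleton.1 huv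
  have h3 : φ (u + v) = 0 := by
    rw [← hc, map_smul, hφ x hx]; simp
  rw [map_add] at h3
  linarith

theorem coneDim_hull_singleton {x : E} (hx : x ≠ 0) : coneDim (PointedCone.hull ℝ {x}) = 1 := by
  have : Submodule.span ℝ ((PointedCone.hull ℝ {x} : PointedCone ℝ E) : Set E)
      = Submodule.span ℝ {x} := by
    apply le_antisymm
    · rw [Submodule.span_le]
      intro y hy
      obtain ⟨c, -, rfl⟩ := mem_hull_singleton.1 hy
      exact Submodule.smul_mem _ _ (Submodule.mem_span_singleton_self x)
    · exact Submodule.span_mono Submodule.subset_span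
  rw [coneDim, this, finrank_span_singleton hx]

/-- Each generator of a simplicial cone spans a ray of the fan. -/
theorem generator_ray (S : StackyFan N) {s : Set E} (hli : LinearIndepOn ℝ id s)
    (hσ : PointedCone.hull ℝ s ∈ S.fan.cones) {x : E} (hx : x ∈ s) :
    PointedCone.hull ℝ {x} ∈ S.fan.rays :=
  ⟨S.fan.face_mem _ hσ _ (isFaceOf_hull_singleton hli hx),
    coneDim_hull_singleton (hli.ne_zero hx)⟩

/-- Linear maps which agree on the `b_ρ` with `ρ ⊆ σ` agree on `σ`. -/
theorem eq_on_cone (S : StackyFan N) {σ : PointedCone ℝ E} (hσ : σ ∈ S.fan.cones)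
    {ℓ ℓ' : E →ₗ[ℝ] ℝ} (h : ∀ ρ : S.fan.rays, ρ.1 ≤ σ → ℓ (S.b ρ) = ℓ' (S.b ρ)) :
    ∀ v ∈ σ, ℓ v = ℓ' v := by
  obtain ⟨s, -, hli, rfl⟩ := S.simplicial σ hσ
  intro v hv
  have key : ∀ x ∈ s, ℓ x = ℓ' x := by
    intro x hx
    have hr := S.generator_ray hli hσ hx
    have hb := S.b_mem ⟨_, hr⟩
    obtain ⟨c, hc, hcx⟩ := mem_hull_singleton.1 hb
    have h1 := h ⟨_, hr⟩ (Submodule.span_mono (Set.singleton_subset_iff.2 hx))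
    have hc0 : c ≠ 0 := by
      rintro rfl
      exact S.b_ne_zero ⟨_, hr⟩ (by rw [← hcx, zero_smul])
    rw [← hcx, map_smul, map_smul] at h1
    exact smul_right_injective ℝ hc0 h1
  have hv' : v ∈ Submodule.span ℝ s := PointedCone.hull_le_span ℝ s hv
  exact LinearMap.eqOn_span (fun x hx => key x hx) hv'

/-- On each cone of the fan there is a linear function with value `1` at the `b_ρ`. -/
theorem exists_linear (S : StackyFan N) {σ : PointedCone ℝ E} (hσ : σ ∈ S.fan.cones) :
    ∃ ℓ : E →ₗ[ℝ] ℝ, ∀ ρ : S.fan.rays, ρ.1 ≤ σ → ℓ (S.b ρ) = 1 := by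
  classical
  obtain ⟨s, hfin, hli, rfl⟩ := S.simplicial σ hσ
  let B := Module.Basis.extend hli
  let g : E → ℝ := fun x =>
    if h : PointedCone.hull ℝ {x} ∈ S.fan.rays then
      (Classical.choose (mem_hull_singleton.1 (S.b_mem ⟨_, h⟩)))⁻¹ else 0
  have hB : ∀ y (hy : y ∈ s), B.constr ℝ (fun i => g i.1) y = g y := by
    intro y hy
    have : B ⟨y, hli.subset_extend _ hy⟩ = y := by simp [B]
    conv_lhs => rw [← this]
    rw [Module.Basis.constr_basis]
  refine ⟨B.constr ℝ (fun i => g i.1), ?_⟩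
  intro ρ hρ
  -- the ray is spanned by one of the generators
  have hface : ρ.1.IsFaceOf (PointedCone.hull ℝ s) := by
    have := (S.fan.inf_isFaceOf ρ.1 ρ.2.1 _ hσ).2
    rwa [inf_eq_left.2 hρ] at this
  have hx : ∃ x ∈ s, x ∈ ρ.1 := by
    by_contra hcon
    push Not at hcon
    have hz : ∀ v ∈ PointedCone.hull ℝ s, v ∈ ρ.1 → v = 0 := by
      intro v hv
      induction hv using Submodule.span_induction with
      | mem y hy => intro h; exact absurd h (hcon y hy)
      | zero => intro _; rfl
      | add a b ha' hb' ha hb =>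
        intro h
        rw [ha (hface.mem_of_add_mem_left ha' hb' h), hb (hface.mem_of_add_mem_right ha' hb' h),
          add_zero]
      | smul c a ha' ha =>
        intro h
        rcases eq_or_lt_of_le (show (0 : ℝ) ≤ c.1 from c.2) with hc | hc
        · have : c = 0 := Subtype.ext hc.symm
          rw [this, zero_smul]
        · have h' : a ∈ ρ.1 := by
            refine hface.mem_of_smul_add_mem ha' (zero_mem _) hc ?_
            rw [add_zero]
            exact h
          rw [ha h', smul_zero]
    exact S.b_ne_zero ρ (hz _ (hρ (S.b_mem ρ)) (S.b_mem ρ))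
  obtain ⟨x, hxs, hxρ⟩ := hx
  have hx0 : x ≠ 0 := hli.ne_zero hxs
  have hρx : PointedCone.hull ℝ {x} = ρ.1 := by
    apply le_antisymm
    · exact Submodule.span_le.2 (Set.singleton_subset_iff.2 hxρ)
    · intro v hv
      have hsp : v ∈ Submodule.span ℝ {x} := by
        have h1 : Submodule.span ℝ {x} ≤ Submodule.span ℝ (ρ.1 : Set E) :=
          Submodule.span_mono (Set.singleton_subset_iff.2 hxρ)
        have hfr : Module.finrank ℝ (Submodule.span ℝ (ρ.1 : Set E)) = 1 := ρ.2.2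
        have : Module.Finite ℝ (Submodule.span ℝ (ρ.1 : Set E)) :=
          Module.finite_of_finrank_eq_succ hfr
        have h2 := Submodule.eq_of_le_of_finrank_eq h1 (by rw [finrank_span_singleton hx0, hfr])
        rw [h2]
        exact Submodule.subset_span hv
      obtain ⟨c, rfl⟩ := Submodule.mem_span_singleton.1 hsp
      rcases le_or_gt 0 c with hc | hc
      · exact mem_hull_singleton.2 ⟨c, hc, rfl⟩
      · exfalso
        have hm : (-c) • x ∈ ρ.1 :=
          Submodule.smul_mem ρ.1 (⟨-c, by linarith⟩ : {r : ℝ // 0 ≤ r}) hxρ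
        refine S.fan.salient ρ.1 ρ.2.1 _ hv (smul_ne_zero hc.ne hx0) ?_
        rw [← neg_smul]
        exact hm
  have hr : PointedCone.hull ℝ {x} ∈ S.fan.rays := hρx ▸ ρ.2
  have hρe : ρ = ⟨_, hr⟩ := Subtype.ext hρx.symm
  have hc := Classical.choose_spec (mem_hull_singleton.1 (S.b_mem ⟨_, hr⟩))
  set c := Classical.choose (mem_hull_singleton.1 (S.b_mem ⟨_, hr⟩)) with hcdef
  have hgx : g x = c⁻¹ := by
    simp only [g]
    rw [dif_pos hr]
  have hc0 : c ≠ 0 := by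
    intro h0
    apply S.b_ne_zero ⟨_, hr⟩
    rw [← hc.2, h0, zero_smul]
  rw [hρe, ← hc.2, map_smul, hB x hxs, hgx, smul_eq_mul, mul_inv_cancel₀ hc0]

theorem exists_isPiecewiseLinear (S : StackyFan N) : ∃ ψ : E → ℝ, S.IsPiecewiseLinear ψ := by
  classical
  choose! L hL using fun (σ : PointedCone ℝ E) (h : σ ∈ S.fan.cones) => S.exists_linear h
  let ψ : E → ℝ := fun v =>
    if h : ∃ σ ∈ S.fan.cones, v ∈ σ then L (Classical.choose h) v else 0
  have key : ∀ σ ∈ S.fan.cones, ∀ v ∈ σ, ψ v = L σ v := by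
    intro σ hσ v hv
    have h : ∃ σ ∈ S.fan.cones, v ∈ σ := ⟨σ, hσ, hv⟩
    simp only [ψ]
    rw [dif_pos h]
    obtain ⟨hτ, hvτ⟩ := Classical.choose_spec h
    set τ := Classical.choose h
    have hκ : σ ⊓ τ ∈ S.fan.cones := S.fan.face_mem σ hσ _ (S.fan.inf_isFaceOf σ hσ τ hτ).1
    refine S.eq_on_cone hκ (fun ρ hρ => ?_) v ⟨hv, hvτ⟩
    rw [hL τ hτ ρ (hρ.trans inf_le_right), hL σ hσ ρ (hρ.trans inf_le_left)]
  refine ⟨ψ, fun σ hσ => ⟨L σ, key σ hσ⟩, fun ρ => ?_⟩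
  rw [key ρ.1 ρ.2.1 _ (S.b_mem ρ)]
  exact hL ρ.1 ρ.2.1 ρ le_rfl

/-- The function `ψ` on `|Σ|` which is linear on each cone and satisfies `ψ(b_ρ) = 1`. (It is
extended to `E` in an arbitrary way; only its values on `|Σ|` are used below, and these are
uniquely determined, see `psi_unique`.) -/
noncomputable def psi (S : StackyFan N) : E → ℝ := Classical.choose S.exists_isPiecewiseLinear

theorem psi_spec (S : StackyFan N) : S.IsPiecewiseLinear S.psi :=
  Classical.choose_spec S.exists_isPiecewiseLinear

theorem psi_unique (S : StackyFan N) {φ : E → ℝ} (hφ : S.IsPiecewiseLinear φ) :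
    Set.EqOn φ S.psi S.fan.support := by
  rintro v ⟨σ, hσ, hv⟩
  obtain ⟨ℓ, hℓ⟩ := hφ.linear σ hσ
  obtain ⟨ℓ', hℓ'⟩ := S.psi_spec.linear σ hσ
  rw [hℓ v hv, hℓ' v hv]
  refine S.eq_on_cone hσ (fun ρ hρ => ?_) v hv
  rw [← hℓ _ (hρ (S.b_mem ρ)), ← hℓ' _ (hρ (S.b_mem ρ)), hφ.map_b, S.psi_spec.map_b]

/-- The lattice complex `Q = {v ∈ |Σ| : ψ(v) ≤ 1}`. -/
def Q (S : StackyFan N) : Set E := {v | v ∈ S.fan.support ∧ S.psi v ≤ 1}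

/-- The weight `w_λ(v) = ψ(v) - ⌈ψ(v)⌉ + λ(v)`. -/
noncomputable def weight (S : StackyFan N) (lam : E → ℝ) (v : E) : ℝ :=
  S.psi v - ⌈S.psi v⌉ + lam v

/-- The lattice points in the dilate `mQ`. -/
def latticePoints (S : StackyFan N) (m : ℕ) : Set E := (N : Set E) ∩ (m : ℝ) • S.Q

/-- `f_k^λ(m)`, the number of lattice points of weight `k` in `mQ`. -/
noncomputable def f (S : StackyFan N) (lam : E → ℝ) (k : ℚ) (m : ℕ) : ℕ :=
  {v ∈ S.latticePoints m | S.weight lam v = (k : ℝ)}.ncard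

end StackyFan

end WeightedEhrhart

/-! Fix a direction ξ outside the span of every cone of positive codimension. Pushing a point
slightly along ξ moves it into the interior of exactly one full-dimensional cone, so space is the
disjoint union of half-open simplicial cones (`IsGeneric.existsUnique_mem_halfOpenCone`). Each cone
has a basis made of the b_ρ, and on it ψ is the sum of coordinates.

A lattice point of a half-open cone is uniquely w + ∑ n_j b_j with w in the half-open box and n_j
natural numbers. The integer shift changes neither the lattice condition nor the weight, so w
contributes the number of tuples with ∑ n_j ≤ m - ⌈ψ(w)⌉, which is a binomial coefficient polynomial
in m of degree d with leading coefficient 1/d! (`ncard_halfOpenCone`). Leading terms cannot cancel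
in the sum.

For reciprocity, w ↦ ∑ b_j - w carries the box for ξ to the box for -ξ and exchanges weights 0 ↔ 0
and k ↔ -1 - k; the binomial polynomials match under it up to (-1)^d (`conePoly_eval_neg`). Since -ξ
is also generic, its polynomial takes the values of the same counting function. -/

namespace WeightedEhrhart

open Polynomial

/-! ### Counting integer points of dilated standard simplices. -/

/-- The tuples of `d` natural numbers whose sum is at most the integer `M`. -/
def simplexTuples (d : ℕ) (M : ℤ) : Finset (Fin d → ℕ) :=
  (Fintype.piFinset fun _ => Finset.range (M.toNat + 1)).filter fun n => ((∑ j, n j : ℕ) : ℤ) ≤ M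

theorem mem_simplexTuples {d : ℕ} {M : ℤ} {n : Fin d → ℕ} :
    n ∈ simplexTuples d M ↔ ((∑ j, n j : ℕ) : ℤ) ≤ M := by
  simp only [simplexTuples, Finset.mem_filter, Fintype.mem_piFinset, Finset.mem_range,
    and_iff_right_iff_imp]
  intro h j
  have := Finset.single_le_sum (fun i _ => Nat.zero_le (n i)) (Finset.mem_univ j)
  omega

/-- Stars and bars: a slack variable M - ∑ n_j turns the inequality into an equation in d + 1
variables. -/
theorem card_simplexTuples_natCast (d M : ℕ) :
    (simplexTuples d M).card = (M + d).choose d := by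
  have h := Finset.card_finsuppAntidiag_nat_eq_choose
    (s := (Finset.univ : Finset (Fin (d + 1)))) M
  rw [Finset.card_univ, Fintype.card_fin, show d + 1 + M - 1 = M + d by omega,
    Nat.choose_symm_add] at h
  rw [← h]
  symm
  refine Finset.card_bij' (fun f _ j => f j.succ)
    (fun n _ => Finsupp.equivFunOnFinite.symm (Fin.cons (M - ∑ j, n j) n)) ?_ ?_ ?_ ?_
  · intro f hf
    simp only [Finset.mem_finsuppAntidiag, Fin.sum_univ_succ] at hf
    rw [mem_simplexTuples]
    omega
  · intro n hn
    rw [mem_simplexTuples] at hn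
    simp only [Finset.mem_finsuppAntidiag, Fin.sum_univ_succ]
    refine ⟨?_, Finset.subset_univ _⟩
    simp
    omega
  · intro f hf
    simp only [Finset.mem_finsuppAntidiag, Fin.sum_univ_succ] at hf
    ext j
    refine Fin.cases ?_ (fun i => ?_) j
    · simp
      omega
    · simp
  · intro n hn
    ext j
    simp

/-- The polynomial `(t - c + 1)(t - c + 2)⋯(t - c + d) / d!`. -/
noncomputable def simplexPoly (d : ℕ) (c : ℤ) : ℚ[X] :=
  C ((d.factorial : ℚ)⁻¹) * ∏ i ∈ Finset.range d, (X + C ((i : ℚ) + 1 - c))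

theorem simplexPoly_eval (d : ℕ) (c : ℤ) (x : ℚ) :
    (simplexPoly d c).eval x =
      (d.factorial : ℚ)⁻¹ * ∏ i ∈ Finset.range d, (x - c + (i + 1)) := by
  rw [simplexPoly, eval_mul, eval_C, eval_prod]
  congr 1
  refine Finset.prod_congr rfl fun i _ => ?_
  simp only [eval_add, eval_X, eval_C]
  ring

theorem simplexPoly_monic_factor (d : ℕ) (c : ℤ) :
    (∏ i ∈ Finset.range d, (X + C ((i : ℚ) + 1 - c))).Monic :=
  monic_prod_of_monic _ _ fun _ _ => monic_X_add_C _

theorem simplexPoly_natDegree_factor (d : ℕ) (c : ℤ) :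
    (∏ i ∈ Finset.range d, (X + C ((i : ℚ) + 1 - c))).natDegree = d := by
  rw [natDegree_prod_of_monic _ _ fun i _ => monic_X_add_C _]
  simp only [natDegree_X_add_C]
  simp

theorem simplexPoly_natDegree_le (d : ℕ) (c : ℤ) : (simplexPoly d c).natDegree ≤ d :=
  (natDegree_C_mul_le _ _).trans (simplexPoly_natDegree_factor d c).le

theorem simplexPoly_coeff (d : ℕ) (c : ℤ) : (simplexPoly d c).coeff d = (d.factorial : ℚ)⁻¹ := by
  have h := (simplexPoly_monic_factor d c).coeff_natDegree
  rw [simplexPoly_natDegree_factor] at h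
  rw [simplexPoly, coeff_C_mul, h, mul_one]

/-- The bound c ≤ d makes the polynomial correct for small m too: if m < c there are no tuples, and
the factor with i = c - m - 1 < d vanishes. -/
theorem card_simplexTuples {d m : ℕ} {c : ℤ} (hc : c ≤ d) :
    ((simplexTuples d (m - c)).card : ℚ) = (simplexPoly d c).eval (m : ℚ) := by
  rw [simplexPoly_eval]
  rcases le_or_gt 0 ((m : ℤ) - c) with h | h
  · obtain ⟨M, hM⟩ := Int.eq_ofNat_of_zero_le h
    have hM' : (m : ℚ) - c = M := by exact_mod_cast hM
    rw [hM, hM', card_simplexTuples_natCast]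
    have h1 := Nat.ascFactorial_eq_factorial_mul_choose M d
    rw [Nat.ascFactorial_eq_prod_range] at h1
    have h2 : (∏ i ∈ Finset.range d, ((M : ℚ) + (i + 1))) = d.factorial * (M + d).choose d := by
      rw [← Nat.cast_mul, ← h1]
      push_cast
      exact Finset.prod_congr rfl fun i _ => by ring
    rw [h2, inv_mul_cancel_left₀ (by exact_mod_cast d.factorial_ne_zero)]
  · have hempty : simplexTuples d (m - c) = ∅ := by
      refine Finset.eq_empty_of_forall_notMem fun n hn => ?_
      rw [mem_simplexTuples] at hn
      omega
    obtain ⟨i, hi⟩ := Int.eq_ofNat_of_zero_le (show 0 ≤ c - m - 1 by omega)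
    rw [hempty, Finset.card_empty, Nat.cast_zero, Finset.prod_eq_zero (i := i), mul_zero]
    · rw [Finset.mem_range]
      omega
    · have : ((c - m - 1 : ℤ) : ℚ) = (i : ℤ) := by rw [hi]
      push_cast at this
      linarith

/-- Negating the d factors and reversing their order yields the factors on the right, since the two
runs of consecutive values are opposite. -/
theorem simplexPoly_eval_neg {d : ℕ} {c c' : ℤ} {x y : ℚ} (h : y - c' = x + c - (d + 1)) :
    (simplexPoly d c).eval (-x) = (-1) ^ d * (simplexPoly d c').eval y := by
  rw [simplexPoly_eval, simplexPoly_eval, mul_left_comm, ← Finset.prod_range_reflect, h]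
  congr 1
  have : ((-1 : ℚ)) ^ d = ∏ _i ∈ Finset.range d, (-1 : ℚ) := by simp
  rw [this, ← Finset.prod_mul_distrib]
  refine Finset.prod_congr rfl fun i hi => ?_
  rw [Finset.mem_range] at hi
  have : ((d - 1 - i : ℕ) : ℚ) = d - 1 - i := by
    rw [Nat.cast_sub (by omega), Nat.cast_sub (by omega)]
    simp
  rw [this]
  ring

end WeightedEhrhart

namespace WeightedEhrhart

open Polynomial Module

/-! ### Half-open simplicial cones and their fundamental boxes. -/

section Cone

variable {E : Type*} [AddCommGroup E] [Module ℝ E] {d : ℕ}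

/-- The sum of the coordinates of `v` with respect to the basis `B`. -/
noncomputable def coordSum (B : Basis (Fin d) ℝ E) (v : E) : ℝ := ∑ j, B.repr v j

/-- The cone generated by the basis `B` without the facets which are invisible from the
direction `ξ`. If `ξ` lies on no facet hyperplane, these are the points `v` for which `v + εξ`
is in the cone for all small `ε > 0`. -/
def halfOpenCone (B : Basis (Fin d) ℝ E) (ξ : E) : Set E :=
  {v | ∀ j, 0 ≤ B.repr v j ∧ (B.repr ξ j < 0 → 0 < B.repr v j)}

/-- The fundamental parallelepiped of `halfOpenCone B ξ`. -/
def halfOpenBox (B : Basis (Fin d) ℝ E) (ξ : E) : Set E :=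
  {v | ∀ j, if B.repr ξ j < 0 then B.repr v j ∈ Set.Ioc (0 : ℝ) 1
    else B.repr v j ∈ Set.Ico (0 : ℝ) 1}

variable {B : Basis (Fin d) ℝ E} {ξ v w : E}

theorem repr_nonneg_of_mem_halfOpenBox (hw : w ∈ halfOpenBox B ξ) (j : Fin d) :
    0 ≤ B.repr w j := by
  have := hw j
  split_ifs at this
  exacts [this.1.le, this.1]

theorem repr_le_one_of_mem_halfOpenBox (hw : w ∈ halfOpenBox B ξ) (j : Fin d) :
    B.repr w j ≤ 1 := by
  have := hw j
  split_ifs at this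
  exacts [this.2, this.2.le]

theorem coordSum_le_of_mem_halfOpenBox (hw : w ∈ halfOpenBox B ξ) : coordSum B w ≤ d := by
  calc coordSum B w ≤ ∑ _j : Fin d, (1 : ℝ) :=
        Finset.sum_le_sum fun j _ => repr_le_one_of_mem_halfOpenBox hw j
    _ = d := by simp

theorem repr_add_sum_nsmul (w : E) (n : Fin d → ℕ) (i : Fin d) :
    B.repr (w + ∑ j, n j • B j) i = B.repr w i + n i := by
  simp_rw [← Nat.cast_smul_eq_nsmul ℝ]
  rw [map_add, Finsupp.add_apply, B.repr_sum_self]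

theorem coordSum_add_sum_nsmul (w : E) (n : Fin d → ℕ) :
    coordSum B (w + ∑ j, n j • B j) = coordSum B w + ((∑ j, n j : ℕ) : ℝ) := by
  simp only [coordSum, repr_add_sum_nsmul, Finset.sum_add_distrib, Nat.cast_sum]

theorem add_sum_nsmul_mem_halfOpenCone (hw : w ∈ halfOpenBox B ξ) (n : Fin d → ℕ) :
    w + ∑ j, n j • B j ∈ halfOpenCone B ξ := by
  intro j
  rw [repr_add_sum_nsmul]
  have hn : (0 : ℝ) ≤ n j := Nat.cast_nonneg _
  refine ⟨add_nonneg (repr_nonneg_of_mem_halfOpenBox hw j) hn, fun hξ => ?_⟩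
  have := hw j
  rw [if_pos hξ] at this
  exact add_pos_of_pos_of_nonneg this.1 hn

/-- Each coordinate of the box ranges over a half-open interval of length 1, which meets every class
modulo 1 once. -/
theorem eq_of_mem_halfOpenBox_of_add_sum_nsmul_eq (hw : w ∈ halfOpenBox B ξ)
    (hv : v ∈ halfOpenBox B ξ) {n n' : Fin d → ℕ}
    (h : w + ∑ j, n j • B j = v + ∑ j, n' j • B j) : w = v ∧ n = n' := by
  have hn : n = n' := by
    funext j
    have hj : B.repr w j + n j = B.repr v j + n' j := by
      rw [← repr_add_sum_nsmul, ← repr_add_sum_nsmul, h]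
    have h1 := hw j
    have h2 := hv j
    have h3 : (n j : ℝ) < n' j + 1 ∧ (n' j : ℝ) < n j + 1 := by
      split_ifs at h1 h2
      · exact ⟨by linarith [h1.1, h2.2], by linarith [h1.2, h2.1]⟩
      · exact ⟨by linarith [h1.1, h2.2], by linarith [h1.2, h2.1]⟩
    have h4 : n j < n' j + 1 := by exact_mod_cast h3.1
    have h5 : n' j < n j + 1 := by exact_mod_cast h3.2
    omega
  subst hn
  exact ⟨add_right_cancel h, rfl⟩

theorem exists_eq_add_sum_nsmul (hv : v ∈ halfOpenCone B ξ) :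
    ∃ w ∈ halfOpenBox B ξ, ∃ n : Fin d → ℕ, v = w + ∑ j, n j • B j := by
  have key : ∀ j, ∃ n : ℕ, if B.repr ξ j < 0 then B.repr v j - n ∈ Set.Ioc (0 : ℝ) 1
      else B.repr v j - n ∈ Set.Ico (0 : ℝ) 1 := by
    intro j
    split_ifs with hξ
    · have hpos := (hv j).2 hξ
      have h1 : 0 < ⌈B.repr v j⌉ := Int.ceil_pos.2 hpos
      -- The remainder must lie in (0, 1], so the integer part is ⌈·⌉ - 1 rather than the floor.
      obtain ⟨n, hn⟩ := Int.eq_ofNat_of_zero_le (show 0 ≤ ⌈B.repr v j⌉ - 1 by omega)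
      have hn' : (n : ℝ) = ⌈B.repr v j⌉ - 1 := by
        have : ((⌈B.repr v j⌉ - 1 : ℤ) : ℝ) = ((n : ℤ) : ℝ) := by rw [hn]
        push_cast at this
        linarith
      refine ⟨n, ?_, ?_⟩
      · have := Int.ceil_lt_add_one (B.repr v j)
        linarith
      · have := Int.le_ceil (B.repr v j)
        linarith
    · refine ⟨⌊B.repr v j⌋₊, ?_, ?_⟩
      · have := Nat.floor_le (hv j).1
        linarith
      · have := Nat.lt_floor_add_one (B.repr v j)
        linarith
  choose n hn using key
  refine ⟨v - ∑ j, n j • B j, fun j => ?_, n, (sub_add_cancel _ _).symm⟩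
  have h : B.repr (v - ∑ j, n j • B j) j = B.repr v j - n j := by
    rw [eq_sub_iff_add_eq, ← repr_add_sum_nsmul, sub_add_cancel]
  rw [h]
  exact hn j

theorem repr_sum_sub (B : Basis (Fin d) ℝ E) (w : E) (i : Fin d) :
    B.repr (∑ j, B j - w) i = 1 - B.repr w i := by
  have := B.repr_sum_self (fun _ => (1 : ℝ))
  simp only [one_smul] at this
  rw [map_sub, Finsupp.sub_apply, this]

theorem coordSum_sum_sub (B : Basis (Fin d) ℝ E) (w : E) :
    coordSum B (∑ j, B j - w) = d - coordSum B w := by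
  simp [coordSum]

/-- The map t ↦ 1 - t swaps (0, 1] and [0, 1), just as the sign change of ξ does. A zero coordinate
of ξ would keep [0, 1) on both sides, hence `hξ`. -/
theorem sum_sub_mem_halfOpenBox (hξ : ∀ j, B.repr ξ j ≠ 0) (hw : w ∈ halfOpenBox B ξ) :
    ∑ j, B j - w ∈ halfOpenBox B (-ξ) := by
  intro j
  have h := hw j
  rw [repr_sum_sub, map_neg, Finsupp.neg_apply]
  rcases lt_or_gt_of_ne (hξ j) with h1 | h1
  · rw [if_pos h1] at h
    rw [if_neg (by linarith)]
    exact ⟨by linarith [h.2], by linarith [h.1]⟩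
  · rw [if_neg (by linarith)] at h
    rw [if_pos (by linarith)]
    exact ⟨by linarith [h.2], by linarith [h.1]⟩

end Cone

/-! ### Lattice points of one half-open cone, and reciprocity for it. -/

section Lattice

variable {E : Type*} [NormedAddCommGroup E] [NormedSpace ℝ E] [FiniteDimensional ℝ E]
  (N : Submodule ℤ E) [DiscreteTopology N] {d : ℕ}

theorem finite_lattice_repr_mem_Icc (B : Basis (Fin d) ℝ E) (r : ℝ) :
    {v : E | v ∈ N ∧ ∀ j, B.repr v j ∈ Set.Icc 0 r}.Finite := by
  have hb : Bornology.IsBounded {v : E | ∀ j, B.repr v j ∈ Set.Icc 0 r} := by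
    have hc : IsCompact (B.equivFunL.symm '' Set.Icc (0 : Fin d → ℝ) (fun _ => r)) :=
      isCompact_Icc.image B.equivFunL.symm.continuous
    refine hc.isBounded.subset fun v hv => ⟨B.equivFun v, ⟨fun j => ?_, fun j => ?_⟩, ?_⟩
    · simpa using (hv j).1
    · simpa using (hv j).2
    · exact B.equivFun.symm_apply_apply v
  have hcl : IsClosed (N : Set E) := by
    have : DiscreteTopology N.toAddSubgroup := inferInstanceAs (DiscreteTopology N)
    exact AddSubgroup.isClosed_of_discrete (H := N.toAddSubgroup)
  have hdisc : IsDiscrete (N : Set E) := ⟨inferInstanceAs (DiscreteTopology N)⟩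
  refine (Metric.finite_isBounded_inter_isClosed hdisc hb hcl).subset fun v hv => ⟨hv.2, hv.1⟩

theorem finite_lattice_halfOpenBox (B : Basis (Fin d) ℝ E) (ξ : E) (k : ℚ) :
    {w : E | w ∈ N ∧ w ∈ halfOpenBox B ξ ∧ coordSum B w - ⌈coordSum B w⌉ = k}.Finite :=
  (finite_lattice_repr_mem_Icc N B 1).subset fun _ hw =>
    ⟨hw.1, fun j => ⟨repr_nonneg_of_mem_halfOpenBox hw.2.1 j,
      repr_le_one_of_mem_halfOpenBox hw.2.1 j⟩⟩

/-- The lattice points of weight `k` in the half-open fundamental parallelepiped. -/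
noncomputable def boxPoints (B : Basis (Fin d) ℝ E) (ξ : E) (k : ℚ) : Finset E :=
  (finite_lattice_halfOpenBox N B ξ k).toFinset

/-- The polynomial which counts the lattice points of weight `k` in dilates of a truncated
half-open cone. -/
noncomputable def conePoly (B : Basis (Fin d) ℝ E) (ξ : E) (k : ℚ) : ℚ[X] :=
  ∑ w ∈ boxPoints N B ξ k, simplexPoly d ⌈coordSum B w⌉

variable {N}

theorem mem_boxPoints {B : Basis (Fin d) ℝ E} {ξ : E} {k : ℚ} {w : E} :
    w ∈ boxPoints N B ξ k ↔
      w ∈ N ∧ w ∈ halfOpenBox B ξ ∧ coordSum B w - ⌈coordSum B w⌉ = k := by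
  simp [boxPoints]

theorem ncard_halfOpenCone {B : Basis (Fin d) ℝ E} (hB : ∀ j, B j ∈ N) (ξ : E) (k : ℚ) (m : ℕ) :
    ({v : E | v ∈ N ∧ v ∈ halfOpenCone B ξ ∧ coordSum B v ≤ m ∧
      coordSum B v - ⌈coordSum B v⌉ = k}.ncard : ℚ) = (conePoly N B ξ k).eval (m : ℚ) := by
  classical
  have hsum : ∀ n : Fin d → ℕ, ∑ j, n j • B j ∈ N := fun n =>
    sum_mem fun j _ => nsmul_mem (hB j) _
  have hle : ∀ (w : E) (n : Fin d → ℕ), coordSum B (w + ∑ j, n j • B j) ≤ m ↔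
      n ∈ simplexTuples d (m - ⌈coordSum B w⌉) := by
    intro w n
    rw [coordSum_add_sum_nsmul, mem_simplexTuples, ← Int.cast_natCast (R := ℝ) m,
      ← Int.ceil_le, Int.ceil_add_natCast]
    omega
  have hwt : ∀ (w : E) (n : Fin d → ℕ),
      coordSum B (w + ∑ j, n j • B j) - ⌈coordSum B (w + ∑ j, n j • B j)⌉ =
        coordSum B w - ⌈coordSum B w⌉ := by
    intro w n
    rw [coordSum_add_sum_nsmul, Int.ceil_add_natCast]
    push_cast
    ring
  have hset : {v : E | v ∈ N ∧ v ∈ halfOpenCone B ξ ∧ coordSum B v ≤ m ∧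
      coordSum B v - ⌈coordSum B v⌉ = k} =
      (((boxPoints N B ξ k).sigma fun w => simplexTuples d (m - ⌈coordSum B w⌉)).image
        fun x => x.1 + ∑ j, x.2 j • B j : Finset E) := by
    ext v
    simp only [Set.mem_ofPred_eq, Finset.coe_image, Set.mem_image, Finset.mem_coe,
      Finset.mem_sigma, mem_boxPoints]
    constructor
    · rintro ⟨hvN, hv, hvm, hvk⟩
      obtain ⟨w, hw, n, rfl⟩ := exists_eq_add_sum_nsmul hv
      rw [hwt] at hvk
      exact ⟨⟨w, n⟩, ⟨⟨(add_mem_cancel_right (hsum n)).1 hvN, hw, hvk⟩, (hle w n).1 hvm⟩, rfl⟩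
    · rintro ⟨⟨w, n⟩, ⟨⟨hwN, hw, hwk⟩, hn⟩, rfl⟩
      exact ⟨add_mem hwN (hsum n), add_sum_nsmul_mem_halfOpenCone hw n, (hle w n).2 hn,
        (hwt w n).trans hwk⟩
  rw [hset, Set.ncard_coe_finset, Finset.card_image_of_injOn, Finset.card_sigma, conePoly,
    eval_finsetSum, Nat.cast_sum]
  · refine Finset.sum_congr rfl fun w hw => card_simplexTuples ?_
    rw [Int.ceil_le]
    exact_mod_cast coordSum_le_of_mem_halfOpenBox (mem_boxPoints.1 hw).2.1
  · rintro ⟨w, n⟩ hx ⟨w', n'⟩ hx' h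
    simp only [Finset.mem_coe, Finset.mem_sigma, mem_boxPoints] at hx hx'
    obtain ⟨rfl, rfl⟩ := eq_of_mem_halfOpenBox_of_add_sum_nsmul_eq hx.1.2.1 hx'.1.2.1 h
    rfl

theorem conePoly_natDegree_le (B : Basis (Fin d) ℝ E) (ξ : E) (k : ℚ) :
    (conePoly N B ξ k).natDegree ≤ d :=
  natDegree_sum_le_of_forall_le _ _ fun _ _ => simplexPoly_natDegree_le _ _

theorem conePoly_coeff (B : Basis (Fin d) ℝ E) (ξ : E) (k : ℚ) :
    (conePoly N B ξ k).coeff d = (boxPoints N B ξ k).card * (d.factorial : ℚ)⁻¹ := by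
  simp [conePoly, simplexPoly_coeff]

/-- Reciprocity for a half-open cone, given how the ceiling changes under `w ↦ ∑ j, B j - w`. -/
theorem conePoly_eval_neg {B : Basis (Fin d) ℝ E} (hB : ∀ j, B j ∈ N) {ξ : E}
    (hξ : ∀ j, B.repr ξ j ≠ 0) {k k' : ℚ} {e : ℤ} (hk : -1 < k) (hk0 : k ≤ 0) (hk' : -1 < k')
    (hk0' : k' ≤ 0) (he : k + k' = -e) {x y : ℚ} (hy : y = x - 1 + e) :
    (conePoly N B ξ k).eval (-x) = (-1) ^ d * (conePoly N B (-ξ) k').eval y := by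
  -- With s = ⌈s⌉ + k and k + k' = -e, one has d - s = (d - ⌈s⌉ + e) + k' with k' in (-1, 0], so the
  -- bracket is the ceiling.
  have hceil : ∀ {k k' : ℚ} (_ : -1 < k') (_ : k' ≤ 0) (_ : k + k' = -e) (w : E),
      coordSum B w - ⌈coordSum B w⌉ = k →
      ⌈coordSum B (∑ j, B j - w)⌉ = d - ⌈coordSum B w⌉ + e := by
    intro k k' hk' hk0' he w hw
    rw [coordSum_sum_sub, Int.ceil_eq_iff]
    have h1 : (k : ℝ) + k' = -e := by exact_mod_cast he
    have h2 : (-1 : ℝ) < k' := by exact_mod_cast hk'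
    have h3 : (k' : ℝ) ≤ 0 := by exact_mod_cast hk0'
    push_cast
    exact ⟨by linarith, by linarith⟩
  have hmem : ∀ {k k' : ℚ} {ξ : E} (_ : ∀ j, B.repr ξ j ≠ 0) (_ : -1 < k') (_ : k' ≤ 0)
      (_ : k + k' = -e), ∀ w ∈ boxPoints N B ξ k, ∑ j, B j - w ∈ boxPoints N B (-ξ) k' := by
    intro k k' ξ hξ hk' hk0' he w hw
    rw [mem_boxPoints] at hw ⊢
    refine ⟨sub_mem (sum_mem fun j _ => hB j) hw.1, sum_sub_mem_halfOpenBox hξ hw.2.1, ?_⟩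
    rw [hceil hk' hk0' he w hw.2.2, coordSum_sum_sub]
    have h1 : (k : ℝ) + k' = -e := by exact_mod_cast he
    have := hw.2.2
    push_cast
    linarith
  rw [conePoly, conePoly, eval_finsetSum, eval_finsetSum, Finset.mul_sum]
  refine Finset.sum_bij' (fun w _ => ∑ j, B j - w) (fun w _ => ∑ j, B j - w)
    (hmem hξ hk' hk0' he) (fun w hw => ?_) (fun w _ => sub_sub_cancel _ _)
    (fun w _ => sub_sub_cancel _ _) (fun w hw => ?_)
  -- The reflection is an involution, so the inverse direction is the same statement for -ξ with the
  -- weights exchanged.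
  · have h := hmem (ξ := -ξ) (k := k') (k' := k) (fun j => by simpa using hξ j) hk hk0
      (by rw [add_comm]; exact he) w hw
    rwa [neg_neg] at h
  · refine simplexPoly_eval_neg ?_
    rw [hceil hk' hk0' he w (mem_boxPoints.1 hw).2.2, hy]
    push_cast
    ring

end Lattice

end WeightedEhrhart

namespace WeightedEhrhart

open Module Filter Topology

/-! ### Faces and interior points of a cone generated by a basis. -/

section Hull

variable {E : Type*} [AddCommGroup E] [Module ℝ E] {d : ℕ}

theorem mem_hull_range_basis {B : Basis (Fin d) ℝ E} {v : E} :
    v ∈ PointedCone.hull ℝ (Set.range B) ↔ ∀ j, 0 ≤ B.repr v j := by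
  constructor
  · intro hv j
    induction hv using Submodule.span_induction with
    | mem y hy =>
      obtain ⟨i, rfl⟩ := hy
      rw [B.repr_self, Finsupp.single_apply]
      split_ifs <;> simp
    | zero => simp
    | add a b _ _ ha hb => rw [map_add]; exact add_nonneg ha hb
    | smul c a _ ha =>
      have : B.repr (c • a) j = c.1 * B.repr a j := by
        rw [← smul_eq_mul, ← Finsupp.smul_apply, ← map_smul]; rfl
      rw [this]
      exact mul_nonneg c.2 ha
  · intro h
    rw [← B.sum_repr v]
    exact sum_mem fun j _ =>
      PointedCone.smul_mem _ (h j) (Submodule.subset_span (Set.mem_range_self j))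

/-- A face of a cone generated by a basis is the whole cone if it meets the interior. -/
theorem le_of_isFaceOf_of_repr_pos {B : Basis (Fin d) ℝ E} {τ : PointedCone ℝ E}
    (h : τ.IsFaceOf (PointedCone.hull ℝ (Set.range B))) {u : E} (hu : u ∈ τ)
    (hpos : ∀ j, 0 < B.repr u j) : PointedCone.hull ℝ (Set.range B) ≤ τ := by
  refine Submodule.span_le.2 ?_
  rintro _ ⟨j, rfl⟩
  rw [← B.sum_repr u] at hu
  exact h.mem_of_sum_smul_mem (fun i => Submodule.subset_span (Set.mem_range_self i))
    (fun i => (hpos i).le) hu j (hpos j)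

/-- The facet of a simplicial cone on which the `j`-th coordinate vanishes. -/
noncomputable def facet (B : Basis (Fin d) ℝ E) (j : Fin d) : PointedCone ℝ E :=
  PointedCone.hull ℝ (Set.range B) ⊓ PointedCone.ofSubmodule (LinearMap.ker (B.coord j))

theorem mem_facet {B : Basis (Fin d) ℝ E} {j : Fin d} {v : E} :
    v ∈ facet B j ↔ v ∈ PointedCone.hull ℝ (Set.range B) ∧ B.repr v j = 0 := by
  rw [facet, Submodule.mem_inf, PointedCone.mem_ofSubmodule_iff, LinearMap.mem_ker,
    Basis.coord_apply]

theorem facet_isFaceOf (B : Basis (Fin d) ℝ E) (j : Fin d) :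
    (facet B j).IsFaceOf (PointedCone.hull ℝ (Set.range B)) := by
  refine PointedCone.IsFaceOf.of_mem_of_add_mem_left (fun v hv => (mem_facet.1 hv).1) ?_
  intro u v hu hv huv
  refine mem_facet.2 ⟨hu, ?_⟩
  have h := (mem_facet.1 huv).2
  rw [map_add, Finsupp.add_apply] at h
  linarith [mem_hull_range_basis.1 hu j, mem_hull_range_basis.1 hv j]

theorem span_facet (B : Basis (Fin d) ℝ E) (j : Fin d) :
    Submodule.span ℝ (facet B j : Set E) = LinearMap.ker (B.coord j) := by
  apply le_antisymm
  · refine Submodule.span_le.2 fun v hv => ?_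
    simpa using (mem_facet.1 hv).2
  · intro v hv
    rw [LinearMap.mem_ker, Basis.coord_apply] at hv
    rw [← B.sum_repr v]
    refine sum_mem fun i _ => ?_
    rcases eq_or_ne i j with rfl | hij
    · rw [hv, zero_smul]
      exact zero_mem _
    · refine Submodule.smul_mem _ _ (Submodule.subset_span (mem_facet.2 ⟨?_, ?_⟩))
      · exact Submodule.subset_span (Set.mem_range_self i)
      · rw [B.repr_self, Finsupp.single_apply, if_neg hij]

theorem span_facet_ne_top (B : Basis (Fin d) ℝ E) (j : Fin d) :
    Submodule.span ℝ (facet B j : Set E) ≠ ⊤ := by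
  intro h
  have hj : B j ∈ LinearMap.ker (B.coord j) := by
    rw [← span_facet, h]
    trivial
  simp at hj

/-- A positive coordinate stays positive under a small push; a zero coordinate occurs in the
half-open cone only where ξ points inward. -/
theorem eventually_repr_pos {B : Basis (Fin d) ℝ E} {v ξ : E} (hξ : ∀ j, B.repr ξ j ≠ 0)
    (hv : v ∈ halfOpenCone B ξ) : ∀ᶠ ε : ℝ in 𝓝[>] 0, ∀ j, 0 < B.repr (v + ε • ξ) j := by
  rw [eventually_all]
  intro j
  have hrepr : ∀ ε : ℝ, B.repr (v + ε • ξ) j = B.repr v j + ε * B.repr ξ j := by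
    intro ε
    simp
  simp only [hrepr]
  rcases (hv j).1.eq_or_lt with h0 | h0
  · have hpos : 0 < B.repr ξ j := by
      rcases lt_or_gt_of_ne (hξ j) with h | h
      · exact absurd ((hv j).2 h) (by rw [← h0]; exact lt_irrefl _)
      · exact h
    filter_upwards [self_mem_nhdsWithin] with ε hε
    rw [← h0, zero_add]
    exact mul_pos hε hpos
  · have hcont : Continuous fun ε : ℝ => B.repr v j + ε * B.repr ξ j := by fun_prop
    have ht := hcont.tendsto 0
    simp only [zero_mul, add_zero] at ht
    exact (ht.mono_left nhdsWithin_le_nhds).eventually (lt_mem_nhds h0)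

end Hull

/-! ### Generic directions and the half-open decomposition of a complete fan. -/

namespace Fan

variable {E : Type*} [AddCommGroup E] [Module ℝ E] {N : Submodule ℤ E}

/-- The full-dimensional cones of a fan. -/
def fullCones (F : Fan N) : Set (PointedCone ℝ E) :=
  {σ | σ ∈ F.cones ∧ Submodule.span ℝ (σ : Set E) = ⊤}

theorem finite_fullCones (F : Fan N) : F.fullCones.Finite :=
  F.finite.subset fun _ h => h.1

/-- A vector is generic if it is in the span of no cone of positive codimension. -/
def IsGeneric (F : Fan N) (ξ : E) : Prop :=
  ∀ σ ∈ F.cones, ξ ∈ Submodule.span ℝ (σ : Set E) → Submodule.span ℝ (σ : Set E) = ⊤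

theorem IsGeneric.neg {F : Fan N} {ξ : E} (h : F.IsGeneric ξ) : F.IsGeneric (-ξ) :=
  fun σ hσ hξ => h σ hσ (neg_mem_iff.1 hξ)

/-- A real vector space is not a finite union of proper subspaces. -/
theorem exists_isGeneric (F : Fan N) : ∃ ξ, F.IsGeneric ξ := by
  classical
  let s : Finset (Subspace ℝ E) :=
    (F.finite.toFinset.image fun σ : PointedCone ℝ E => Submodule.span ℝ (σ : Set E)).filter (· ≠ ⊤)
  have hs : ⊤ ∉ s := by simp [s]
  obtain ⟨ξ, hξ⟩ := (Set.ne_univ_iff_exists_notMem _).1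
    (Subspace.biUnion_ne_univ_of_top_notMem hs)
  refine ⟨ξ, fun σ hσ hmem => ?_⟩
  by_contra hne
  refine hξ (Set.mem_biUnion (x := Submodule.span ℝ (σ : Set E)) ?_ hmem)
  simp only [s, Finset.coe_filter, Finset.mem_image, Set.Finite.mem_toFinset]
  exact ⟨⟨σ, hσ, rfl⟩, hne⟩

/-- The hyperplane where a coordinate vanishes is the span of a facet, and facets belong to the fan.
-/
theorem IsGeneric.repr_ne_zero {F : Fan N} {ξ : E} (h : F.IsGeneric ξ) {d : ℕ}
    {B : Basis (Fin d) ℝ E} (hB : PointedCone.hull ℝ (Set.range B) ∈ F.cones) (j : Fin d) :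
    B.repr ξ j ≠ 0 := by
  intro h0
  refine span_facet_ne_top B j (h _ (F.face_mem _ hB _ (facet_isFaceOf B j)) ?_)
  rw [span_facet]
  simpa using h0

/-- In a complete fan, all points `v + εξ` with `ε` in some sequence tending to `0` are in a
common cone, which is full-dimensional if `ξ` is generic. -/
theorem IsGeneric.exists_frequently_mem {F : Fan N} {ξ : E} (h : F.IsGeneric ξ)
    (hF : F.IsComplete) (v : E) :
    ∃ σ ∈ F.fullCones, ∃ᶠ n : ℕ in atTop, v + (1 / ((n : ℝ) + 1)) • ξ ∈ σ := by
  have hex : ∀ n : ℕ, ∃ σ : F.cones, v + (1 / ((n : ℝ) + 1)) • ξ ∈ σ.1 := by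
    intro n
    have hmem : v + (1 / ((n : ℝ) + 1)) • ξ ∈ F.support := by
      rw [show F.support = Set.univ from hF]
      trivial
    obtain ⟨σ, hσ, hmem⟩ := hmem
    exact ⟨⟨σ, hσ⟩, hmem⟩
  choose g hg using hex
  have : Finite F.cones := F.finite
  obtain ⟨σ, hσ⟩ := Finite.exists_infinite_fiber g
  have hinf : (g ⁻¹' {σ}).Infinite := Set.infinite_coe_iff.1 hσ
  have hin : ∀ n ∈ g ⁻¹' {σ}, v + (1 / ((n : ℝ) + 1)) • ξ ∈ σ.1 := by
    intro n hn
    rw [← show g n = σ from hn]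
    exact hg n
  refine ⟨σ.1, ⟨σ.2, h σ.1 σ.2 ?_⟩, (Nat.frequently_atTop_iff_infinite.2 hinf).mono hin⟩
  obtain ⟨n, hn⟩ := hinf.nonempty
  obtain ⟨m, hm, hnm⟩ := hinf.exists_gt n
  -- The difference of two such points is a nonzero multiple of ξ, so ξ lies in the span of the
  -- cone, and genericity applies.
  have hsub := sub_mem (Submodule.subset_span (R := ℝ) (hin n hn))
    (Submodule.subset_span (R := ℝ) (hin m hm))
  rw [add_sub_add_left_eq_sub, ← sub_smul] at hsub
  refine (Submodule.smul_mem_iff _ (sub_ne_zero.2 ?_)).1 hsub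
  have : (n : ℝ) < m := by exact_mod_cast hnm
  exact (one_div_lt_one_div_of_lt (by positivity) (by linarith)).ne'

/-- Existence: a cone containing v + εξ for arbitrarily small ε contains v in the limit, and a zero
coordinate of v cannot go with a negative one of ξ. Uniqueness: for small ε the point v + εξ is
interior to both cones, so their common face is all of each. -/
theorem IsGeneric.existsUnique_mem_halfOpenCone {F : Fan N} {ξ : E} (h : F.IsGeneric ξ)
    (hF : F.IsComplete) {d : ℕ} {B : F.fullCones → Basis (Fin d) ℝ E}
    (hB : ∀ σ, PointedCone.hull ℝ (Set.range (B σ)) = σ.1) (v : E) :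
    ∃! σ, v ∈ halfOpenCone (B σ) ξ := by
  have hcone : ∀ σ, PointedCone.hull ℝ (Set.range (B σ)) ∈ F.cones := fun σ => by
    rw [hB]
    exact σ.2.1
  apply existsUnique_of_exists_of_unique
  · obtain ⟨σ, hσ, hfreq⟩ := h.exists_frequently_mem hF v
    refine ⟨⟨σ, hσ⟩, fun j => ?_⟩
    set b := B ⟨σ, hσ⟩ with hb
    have hfr : ∃ᶠ n : ℕ in atTop, 0 ≤ b.repr v j + (1 / ((n : ℝ) + 1)) * b.repr ξ j := by
      refine hfreq.mono fun n hn => ?_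
      rw [← show _ = σ from hB ⟨σ, hσ⟩, mem_hull_range_basis] at hn
      simpa using hn j
    have hnn : 0 ≤ b.repr v j := by
      refine ge_of_tendsto_of_frequently ?_ hfr
      have ht := (tendsto_one_div_add_atTop_nhds_zero_nat (𝕜 := ℝ)).mul_const (b.repr ξ j)
      simpa using ht.const_add (b.repr v j)
    refine ⟨hnn, fun hneg => hnn.lt_of_ne fun h0 => ?_⟩
    obtain ⟨n, hn⟩ := hfr.exists
    rw [← h0, zero_add] at hn
    have hpos : (0 : ℝ) < 1 / ((n : ℝ) + 1) := by positivity
    exact absurd hn (not_le.2 (mul_neg_of_pos_of_neg hpos hneg))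
  · intro σ τ hσ hτ
    obtain ⟨ε, hε, hε'⟩ := ((eventually_repr_pos (h.repr_ne_zero (hcone σ)) hσ).and
      (eventually_repr_pos (h.repr_ne_zero (hcone τ)) hτ)).exists
    have hu : v + ε • ξ ∈ PointedCone.hull ℝ (Set.range (B σ)) ⊓
        PointedCone.hull ℝ (Set.range (B τ)) :=
      ⟨mem_hull_range_basis.2 fun j => (hε j).le, mem_hull_range_basis.2 fun j => (hε' j).le⟩
    have hface := F.inf_isFaceOf _ (hcone σ) _ (hcone τ)
    have h1 := le_of_isFaceOf_of_repr_pos hface.1 hu hε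
    have h2 := le_of_isFaceOf_of_repr_pos hface.2 hu hε'
    apply Subtype.ext
    rw [← hB σ, ← hB τ]
    exact le_antisymm (h1.trans inf_le_right) (h2.trans inf_le_left)

end Fan

/-! ### Bases consisting of the b_ρ, and ψ in their coordinates. -/

namespace StackyFan

variable {E : Type*} [AddCommGroup E] [Module ℝ E] {N : Submodule ℤ E}

theorem b_mem_lattice (S : StackyFan N) (ρ : S.fan.rays) : S.b ρ ∈ N := by
  obtain ⟨v, a, hv, -, h⟩ := S.b_spec ρ
  rw [h]
  exact nsmul_mem hv.mem_lattice a

/-- A full-dimensional cone is generated by a basis consisting of the `b_ρ`. -/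
theorem exists_basis (S : StackyFan N) {d : ℕ} (hd : finrank ℝ E = d) {σ : PointedCone ℝ E}
    (hσ : σ ∈ S.fan.fullCones) :
    ∃ B : Basis (Fin d) ℝ E, PointedCone.hull ℝ (Set.range B) = σ ∧
      ∀ j, ∃ ρ : S.fan.rays, B j = S.b ρ := by
  obtain ⟨hσ, hspan⟩ := hσ
  obtain ⟨s, hfin, hli, rfl⟩ := S.simplicial σ hσ
  have : Fintype s := hfin.fintype
  have htop : ⊤ ≤ Submodule.span ℝ (Set.range (fun x : s => id x.1)) := by
    rw [← hspan]
    refine Submodule.span_le.2 fun v hv => ?_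
    have := PointedCone.hull_le_span ℝ s hv
    simpa using this
  have hray : ∀ x : s, PointedCone.hull ℝ {x.1} ∈ S.fan.rays := fun x =>
    S.generator_ray hli hσ x.2
  have hc : ∀ x : s, ∃ c : ℝ, 0 < c ∧ c • x.1 = S.b ⟨_, hray x⟩ := by
    intro x
    obtain ⟨c, hc, hcx⟩ := mem_hull_singleton.1 (S.b_mem ⟨_, hray x⟩)
    refine ⟨c, hc.lt_of_ne ?_, hcx⟩
    rintro rfl
    exact S.b_ne_zero ⟨_, hray x⟩ (by rw [← hcx, zero_smul])
  choose c hc hcb using hc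
  let B₀ : Basis s ℝ E := Basis.mk hli htop
  -- Each b_ρ is a positive multiple of the generator on its ray, so this rescaling does not change
  -- the cone.
  let B₁ : Basis s ℝ E := B₀.isUnitSMul fun x => (hc x).ne'.isUnit
  have hB₁ : ∀ x, B₁ x = c x • x.1 := fun x => by
    simp [B₁, B₀, Basis.isUnitSMul_apply]
  have hcard : Fintype.card s = d := by rw [← hd, finrank_eq_card_basis B₁]
  let e := Fintype.equivFinOfCardEq hcard
  refine ⟨B₁.reindex e, ?_, fun j => ⟨⟨_, hray (e.symm j)⟩, ?_⟩⟩
  · rw [Basis.range_reindex]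
    apply le_antisymm
    · refine Submodule.span_le.2 ?_
      rintro _ ⟨x, rfl⟩
      rw [hB₁]
      exact PointedCone.smul_mem _ (hc x).le (Submodule.subset_span x.2)
    · refine Submodule.span_le.2 fun x hx => ?_
      have h1 : x = (c ⟨x, hx⟩)⁻¹ • B₁ ⟨x, hx⟩ := by
        rw [hB₁, inv_smul_smul₀ (hc _).ne']
      rw [h1]
      exact PointedCone.smul_mem _ (inv_nonneg.2 (hc _).le)
        (Submodule.subset_span (Set.mem_range_self _))
  · rw [Basis.reindex_apply, hB₁, hcb]

theorem psi_eq_coordSum (S : StackyFan N) {d : ℕ} {B : Basis (Fin d) ℝ E}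
    (hB : PointedCone.hull ℝ (Set.range B) ∈ S.fan.cones)
    (hb : ∀ j, ∃ ρ : S.fan.rays, B j = S.b ρ) {v : E} (hv : ∀ j, 0 ≤ B.repr v j) :
    S.psi v = coordSum B v := by
  obtain ⟨ℓ, hℓ⟩ := S.psi_spec.linear _ hB
  have h1 : ∀ j, ℓ (B j) = 1 := by
    intro j
    rw [← hℓ _ (Submodule.subset_span (Set.mem_range_self j))]
    obtain ⟨ρ, hρ⟩ := hb j
    rw [hρ, S.psi_spec.map_b]
  rw [hℓ v (mem_hull_range_basis.2 hv)]
  conv_lhs => rw [← B.sum_repr v]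
  rw [map_sum]
  simp only [map_smul, h1, smul_eq_mul, mul_one, coordSum]

theorem psi_smul (S : StackyFan N) {v : E} (hv : v ∈ S.fan.support) {c : ℝ} (hc : 0 ≤ c) :
    S.psi (c • v) = c * S.psi v := by
  obtain ⟨σ, hσ, hv⟩ := hv
  obtain ⟨ℓ, hℓ⟩ := S.psi_spec.linear σ hσ
  rw [hℓ v hv, hℓ _ (PointedCone.smul_mem _ hc hv), map_smul, smul_eq_mul]

end StackyFan

end WeightedEhrhart

namespace WeightedEhrhart

open Polynomial Module

/-! ### Summation over the full-dimensional cones. -/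

section Complete

variable {E : Type*} [NormedAddCommGroup E] [NormedSpace ℝ E]
  {N : Submodule ℤ E} {d : ℕ}

/-- A choice, for every full-dimensional cone, of a basis of `E` consisting of the `b_ρ` which
generates the cone. -/
structure ConeBases (S : StackyFan N) (d : ℕ) where
  /-- The basis generating a full-dimensional cone. -/
  basis : S.fan.fullCones → Basis (Fin d) ℝ E
  hull_eq : ∀ σ, PointedCone.hull ℝ (Set.range (basis σ)) = σ.1
  eq_b : ∀ σ j, ∃ ρ : S.fan.rays, basis σ j = S.b ρ

namespace ConeBases

theorem nonempty (S : StackyFan N) (hd : finrank ℝ E = d) : Nonempty (ConeBases S d) := by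
  choose B hB hb using fun σ : S.fan.fullCones => S.exists_basis hd σ.2
  exact ⟨⟨B, hB, hb⟩⟩

variable {S : StackyFan N} (D : ConeBases S d)

theorem hull_mem (σ : S.fan.fullCones) :
    PointedCone.hull ℝ (Set.range (D.basis σ)) ∈ S.fan.cones := by
  rw [D.hull_eq]
  exact σ.2.1

theorem basis_mem (σ : S.fan.fullCones) (j : Fin d) : D.basis σ j ∈ N := by
  obtain ⟨ρ, hρ⟩ := D.eq_b σ j
  rw [hρ]
  exact S.b_mem_lattice ρ

theorem psi_eq {σ : S.fan.fullCones} {v : E} (hv : ∀ j, 0 ≤ (D.basis σ).repr v j) :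
    S.psi v = coordSum (D.basis σ) v :=
  S.psi_eq_coordSum (D.hull_mem σ) (D.eq_b σ) hv

theorem exists_repr_nonneg (hS : S.fan.IsComplete) (v : E) :
    ∃ σ, ∀ j, 0 ≤ (D.basis σ).repr v j := by
  obtain ⟨ξ, hξ⟩ := S.fan.exists_isGeneric
  obtain ⟨σ, hσ, -⟩ := hξ.existsUnique_mem_halfOpenCone hS D.hull_eq v
  exact ⟨σ, fun j => (hσ j).1⟩

theorem mem_latticePoints (D : ConeBases S d) (hS : S.fan.IsComplete) {m : ℕ} {v : E} :
    v ∈ S.latticePoints m ↔ v ∈ N ∧ S.psi v ≤ m := by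
  have hsupp : ∀ u : E, u ∈ S.fan.support := fun u => by
    rw [show S.fan.support = Set.univ from hS]
    trivial
  refine and_congr_right fun _ => ?_
  rw [Set.mem_smul_set]
  constructor
  · rintro ⟨u, hu, rfl⟩
    rw [S.psi_smul (hsupp u) (Nat.cast_nonneg m)]
    exact mul_le_of_le_one_right (Nat.cast_nonneg m) hu.2
  · intro hv
    -- Division by m fails for m = 0; there the dilate is {0}, and ψ(v) ≤ 0 forces all coordinates
    -- of v to vanish.
    rcases Nat.eq_zero_or_pos m with rfl | hm
    · obtain ⟨σ, hσ⟩ := D.exists_repr_nonneg hS v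
      have hz : ∀ j, (D.basis σ).repr v j = 0 := by
        rw [D.psi_eq hσ, Nat.cast_zero] at hv
        have h0 := le_antisymm hv (Finset.sum_nonneg fun j _ => hσ j)
        intro j
        exact (Finset.sum_eq_zero_iff_of_nonneg fun j _ => hσ j).1 h0 j (Finset.mem_univ j)
      have hv0 : v = 0 := by
        rw [← (D.basis σ).sum_repr v]
        simp only [hz, zero_smul, Finset.sum_const_zero]
      refine ⟨0, ⟨hsupp 0, ?_⟩, by rw [hv0, smul_zero]⟩
      have := S.psi_smul (hsupp 0) (le_refl (0 : ℝ))
      rw [smul_zero, zero_mul] at this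
      rw [this]
      exact zero_le_one
    · have hm' : (0 : ℝ) < m := by exact_mod_cast hm
      refine ⟨(m : ℝ)⁻¹ • v, ⟨hsupp _, ?_⟩, smul_inv_smul₀ hm'.ne' v⟩
      rw [S.psi_smul (hsupp v) (inv_nonneg.2 hm'.le)]
      rwa [inv_mul_le_iff₀ hm', mul_one]

variable [FiniteDimensional ℝ E] [DiscreteTopology N]

theorem finite_latticePoints (D : ConeBases S d) (hS : S.fan.IsComplete) (m : ℕ) :
    (S.latticePoints m).Finite := by
  have : Finite S.fan.fullCones := S.fan.finite_fullCones
  refine (Set.finite_iUnion fun σ => finite_lattice_repr_mem_Icc N (D.basis σ) m).subset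
    fun v hv => ?_
  rw [D.mem_latticePoints hS] at hv
  obtain ⟨σ, hσ⟩ := D.exists_repr_nonneg hS v
  refine Set.mem_iUnion.2 ⟨σ, hv.1, fun j => ⟨hσ j, le_trans ?_ hv.2⟩⟩
  rw [D.psi_eq hσ]
  exact Finset.single_le_sum (f := fun j => (D.basis σ).repr v j) (fun i _ => hσ i)
    (Finset.mem_univ j)

/-- The polynomial which counts the lattice points of weight `k`, obtained from the half-open
decomposition of the fan in the direction `ξ`. -/
noncomputable def poly (ξ : E) (k : ℚ) : ℚ[X] :=
  ∑ᶠ σ, conePoly N (D.basis σ) ξ k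

theorem poly_eq_sum [Fintype S.fan.fullCones] (ξ : E) (k : ℚ) :
    D.poly ξ k = ∑ σ, conePoly N (D.basis σ) ξ k :=
  finsum_eq_sum_of_fintype _

/-- The left side does not involve ξ, so ξ and -ξ may be interchanged when evaluating at natural
numbers. -/
theorem f_eq_eval_poly (hS : S.fan.IsComplete) {ξ : E} (hξ : S.fan.IsGeneric ξ) (k : ℚ) (m : ℕ) :
    (S.f 0 k m : ℚ) = (D.poly ξ k).eval (m : ℚ) := by
  have : Fintype S.fan.fullCones := S.fan.finite_fullCones.fintype
  let A : S.fan.fullCones → Set E := fun σ =>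
    {v : E | v ∈ N ∧ v ∈ halfOpenCone (D.basis σ) ξ ∧ coordSum (D.basis σ) v ≤ m ∧
      coordSum (D.basis σ) v - ⌈coordSum (D.basis σ) v⌉ = k}
  have hdec := hξ.existsUnique_mem_halfOpenCone hS D.hull_eq
  have hiff : ∀ {σ v}, v ∈ halfOpenCone (D.basis σ) ξ →
      (v ∈ {v ∈ S.latticePoints m | S.weight 0 v = (k : ℝ)} ↔ v ∈ A σ) := by
    intro σ v hv
    have hpsi := D.psi_eq fun j => (hv j).1
    simp only [Set.mem_ofPred_eq, D.mem_latticePoints hS, StackyFan.weight, Pi.zero_apply, add_zero,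
      hpsi, A, hv, true_and, and_assoc]
  have hunion : {v ∈ S.latticePoints m | S.weight 0 v = (k : ℝ)} = ⋃ σ, A σ := by
    ext v
    rw [Set.mem_iUnion]
    constructor
    · intro hv
      obtain ⟨σ, hσ, -⟩ := hdec v
      exact ⟨σ, (hiff hσ).1 hv⟩
    · rintro ⟨σ, hv⟩
      exact (hiff hv.2.1).2 hv
  have hfin : ∀ σ, (A σ).Finite := fun σ =>
    (D.finite_latticePoints hS m).subset fun v hv => ((hiff hv.2.1).2 hv).1
  have hdisj : Pairwise (Function.onFun Disjoint A) := by
    intro σ τ hστ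
    refine Set.disjoint_left.2 fun v hv hv' => hστ ?_
    exact (hdec v).unique hv.2.1 hv'.2.1
  rw [StackyFan.f, hunion, Set.ncard_iUnion_of_finite hfin hdisj, finsum_eq_sum_of_fintype,
    Nat.cast_sum, D.poly_eq_sum, eval_finsetSum]
  exact Finset.sum_congr rfl fun σ _ => ncard_halfOpenCone (D.basis_mem σ) ξ k m

/-- Every box point adds 1/d! to the coefficient of degree d, so this coefficient vanishes only if
there are no box points at all. -/
theorem poly_eq_zero_or (ξ : E) (k : ℚ) :
    D.poly ξ k = 0 ∨ ((D.poly ξ k).natDegree = d ∧ 0 < (D.poly ξ k).leadingCoeff) := by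
  have : Fintype S.fan.fullCones := S.fan.finite_fullCones.fintype
  have hdeg : (D.poly ξ k).natDegree ≤ d := by
    rw [D.poly_eq_sum]
    exact natDegree_sum_le_of_forall_le _ _ fun _ _ => conePoly_natDegree_le _ _ _
  have hcoeff : (D.poly ξ k).coeff d =
      ((∑ σ, (boxPoints N (D.basis σ) ξ k).card : ℕ) : ℚ) * (d.factorial : ℚ)⁻¹ := by
    rw [D.poly_eq_sum, finsetSum_coeff, Nat.cast_sum, Finset.sum_mul]
    exact Finset.sum_congr rfl fun σ _ => conePoly_coeff _ _ _
  rcases Nat.eq_zero_or_pos (∑ σ, (boxPoints N (D.basis σ) ξ k).card) with h | h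
  · left
    rw [D.poly_eq_sum]
    refine Finset.sum_eq_zero fun σ hσ => ?_
    rw [conePoly, Finset.card_eq_zero.1 (Finset.sum_eq_zero_iff.1 h σ hσ), Finset.sum_empty]
  · right
    have hpos : 0 < (D.poly ξ k).coeff d := by
      rw [hcoeff]
      positivity
    have hd : (D.poly ξ k).natDegree = d := natDegree_eq_of_le_of_coeff_ne_zero hdeg hpos.ne'
    exact ⟨hd, by rwa [leadingCoeff, hd]⟩

theorem poly_eval_neg {ξ : E} (hξ : S.fan.IsGeneric ξ) {k k' : ℚ} {e : ℤ} (hk : -1 < k)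
    (hk0 : k ≤ 0) (hk' : -1 < k') (hk0' : k' ≤ 0) (he : k + k' = -e) {x y : ℚ}
    (hy : y = x - 1 + e) :
    (D.poly ξ k).eval (-x) = (-1) ^ d * (D.poly (-ξ) k').eval y := by
  have : Fintype S.fan.fullCones := S.fan.finite_fullCones.fintype
  rw [D.poly_eq_sum, D.poly_eq_sum, eval_finsetSum, eval_finsetSum, Finset.mul_sum]
  exact Finset.sum_congr rfl fun σ _ => conePoly_eval_neg (D.basis_mem σ)
    (hξ.repr_ne_zero (D.hull_mem σ)) hk hk0 hk' hk0' he hy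

end ConeBases

end Complete

end WeightedEhrhart

/-- Weighted Ehrhart reciprocity for a complete stacky fan on a lattice `N` of rank `d`. The value
`f^0_k(-m)` is the value at `-m` of the polynomial `p` which agrees with `f^0_k` on `ℕ`. -/
theorem theorem3p6 {E : Type*} [NormedAddCommGroup E] [NormedSpace ℝ E] [FiniteDimensional ℝ E]
    (N : Submodule ℤ E) [DiscreteTopology N] [IsZLattice ℝ N]
    (d : ℕ) (hd : Module.finrank ℤ N = d)
    (S : WeightedEhrhart.StackyFan N) (hS : S.fan.IsComplete) :
    (∀ m : ℕ, (S.latticePoints m).Finite) ∧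
    ∀ k : ℚ, -1 < k → k ≤ 0 →
      ∃ p : Polynomial ℚ,
        (∀ m : ℕ, (S.f 0 k m : ℚ) = p.eval (m : ℚ)) ∧
        (p = 0 ∨ (p.natDegree = d ∧ 0 < p.leadingCoeff)) ∧
        ∀ m : ℕ, 0 < m →
          p.eval (-(m : ℚ)) =
            if k = 0 then (-1) ^ d * (S.f 0 k (m - 1) : ℚ)
            else (-1) ^ d * (S.f 0 (-1 - k) m : ℚ) := by
  obtain ⟨D⟩ := WeightedEhrhart.ConeBases.nonempty S ((ZLattice.rank ℝ N).symm.trans hd)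
  obtain ⟨ξ, hξ⟩ := S.fan.exists_isGeneric
  refine ⟨D.finite_latticePoints hS, fun k hk hk0 => ⟨D.poly ξ k, D.f_eq_eval_poly hS hξ k,
    D.poly_eq_zero_or ξ k, fun m hm => ?_⟩⟩
  split_ifs with h
  · rw [D.f_eq_eval_poly hS hξ.neg]
    -- Here k' = k = 0, so e = 0 and the evaluation point is m - 1; for k < 0, k' = -1 - k gives e =
    -- 1 and the point m.
    refine D.poly_eval_neg hξ (e := 0) hk hk0 hk hk0 (by simp [h]) ?_
    rw [Nat.cast_pred hm]
    simp
  · rw [D.f_eq_eval_poly hS hξ.neg]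
    have hk0' : k < 0 := lt_of_le_of_ne hk0 h
    exact D.poly_eval_neg hξ (e := 1) hk hk0 (by linarith) (by linarith) (by push_cast; ring)
      (by simp)
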